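/- For a finite simple graph $G$, let $\mathcal{S}(G)$ be the set of real symmetric matrices, indexed by $V(G)$, whose $(i,j)$-entry with $i\neq j$ is nonzero if and only if $\{i,j\}\in E(G)$ (the diagonal is unconstrained). A real symmetric matrix $A$ has the strong spectral property (SSP) if $X=O$ is the only symmetric matrix with $A\circ X=I\circ X=O$ and $AX-XA=O$, where $\circ$ is the entrywise product. If $\overline{K}$ is the complement of a graph $K$ obtained from $G$ by adding edges, then $A\in\mathcal{S}(G)$ has the SSP with respect to $K$ if $X=O$ is the only symmetric matrix with zero diagonal such that $X_{i,j}\neq 0$ only for $\{i,j\}\in E(\overline{K})$ and $AX-XA=O$. A nonempty set $\beta\subseteq E(\overline{G})$ is an SSP liberation set of $A\in\mathcal{S}(G)$ if $A$ has the SSP with respect to $G+\beta'$ for every $\beta'\subset\beta$ with $|\beta'|=|\beta|-1$, where $G+\beta'$ is $G$ with the edges $\beta'$ added. A $d$-dimensional subspace of $\mathbb{R}^n$ is generic if every $d\times d$ submatrix of an $n\times d$ matrix whose columns form a basis of it is invertible. Spectra are multisets, with $\operatorname{mult}_A(\lambda)$ the multiplicity of $\lambda$ in $\operatorname{spec}(A)$.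 Write $G\mathbin{\dot\cup}H$ for the disjoint union of graphs, and regard a pair $(u,v)\in V(G)\times V(H)$ as the edge $\{u,v\}$ between $G$ and $H$. **Theorem.** Let $A\in\mathcal{S}(G)$ and $B\in\mathcal{S}(H)$ have the SSP. Suppose that $\lambda$ is the only common eigenvalue of $A$ and $B$, that $\operatorname{mult}_A(\lambda)=k$ and $\operatorname{mult}_B(\lambda)=1$, and that $\ker(A-\lambda I)$ and $\ker(B-\lambda I)$ are generic. Let $\beta\subseteq V(G)\times V(H)$ be such that - $|\beta\cap(\{u\}\times V(H))|=2$ for $k$ distinct $u\in V(G)$ (other vertices being unrestricted), or - $|\beta\cap(V(G)\times\{v\})|=k+1$ for some $v\in V(H)$, or - $k=1$ and $|\beta|=2$. Then $\beta$ is an SSP liberation set of $A\oplus B$. In particular, there is a matrix $C\in\mathcal{S}(G\mathbin{\dot\cup}H+\beta)$ with the SSP such that $\operatorname{spec}(C)=\operatorname{spec}(A)\cup\operatorname{spec}(B)$, where the union adds multiplicities. -/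

import Mathlib

namespace LiberationSet

open Matrix SimpleGraph

/-- `𝒮(G)`: the real symmetric matrices whose off-diagonal `(i,j)`-entry is nonzero exactly when
`{i,j}` is an edge of `G`; the diagonal is unconstrained. -/
def graphMatrices {V : Type*} (G : SimpleGraph V) : Set (Matrix V V ℝ) :=
  {A | A.IsSymm ∧ ∀ i j, i ≠ j → (A i j ≠ 0 ↔ G.Adj i j)}

/-- `𝒮₀ᶜˡ(G)`: the real symmetric matrices whose `(i,j)`-entry is nonzero only when `{i,j}` is an
edge of `G`; in particular the diagonal is zero. -/
def zeroDiagClosure {V : Type*} (G : SimpleGraph V) : Set (Matrix V V ℝ) :=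
  {X | X.IsSymm ∧ ∀ i j, X i j ≠ 0 → G.Adj i j}

/-- The strong spectral property of a symmetric matrix `A`: the only symmetric `X` with
`A ∘ X = I ∘ X = O` and `[A, X] = O` is `X = O`. -/
def HasSSP {V : Type*} [Fintype V] [DecidableEq V] (A : Matrix V V ℝ) : Prop :=
  A.IsSymm ∧ ∀ X : Matrix V V ℝ, X.IsSymm →
    A ⊙ X = 0 → (1 : Matrix V V ℝ) ⊙ X = 0 → A * X - X * A = 0 → X = 0

/-- The strong spectral property of `A` with respect to the graph `H`. It is only used for
`A ∈ 𝒮(G)` with `G` a spanning subgraph of `H`. -/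
def HasSSPWrt {V : Type*} [Fintype V] (A : Matrix V V ℝ) (H : SimpleGraph V) : Prop :=
  ∀ X ∈ zeroDiagClosure Hᶜ, A * X - X * A = 0 → X = 0

/-- The spanning supergraph `G + β`. -/
def addEdges {V : Type*} (G : SimpleGraph V) (β : Set (Sym2 V)) : SimpleGraph V :=
  G ⊔ SimpleGraph.fromEdgeSet β

/-- `β` is an SSP liberation set of `A ∈ 𝒮(G)`: it is a nonempty set of non-edges of `G`, and
`A` has the SSP with respect to `G + β'` for every `β' ⊂ β` with `|β'| = |β| - 1`. -/
def IsSSPLiberationSet {V : Type*} [Fintype V] (G : SimpleGraph V) (A : Matrix V V ℝ)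
    (β : Set (Sym2 V)) : Prop :=
  A ∈ graphMatrices G ∧ β.Nonempty ∧ β ⊆ Gᶜ.edgeSet ∧
    ∀ β' ⊆ β, β'.ncard + 1 = β.ncard → HasSSPWrt A (addEdges G β')

/-- The spectrum of `A` as a multiset. (A real symmetric matrix has only real eigenvalues, and
their algebraic and geometric multiplicities agree.) -/
noncomputable def spec {V : Type*} [Fintype V] [DecidableEq V] (A : Matrix V V ℝ) : Multiset ℝ :=
  A.charpoly.roots

/-- The multiplicity of `μ` as an eigenvalue of `A`. -/
noncomputable def mult {V : Type*} [Fintype V] [DecidableEq V] (A : Matrix V V ℝ) (μ : ℝ) : ℕ :=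
  (spec A).count μ

/-- The kernel of `A - μ I`. -/
noncomputable def eigenKer {V : Type*} [Fintype V] [DecidableEq V] (A : Matrix V V ℝ) (μ : ℝ) :
    Submodule ℝ (V → ℝ) :=
  LinearMap.ker (A - μ • (1 : Matrix V V ℝ)).mulVecLin

/-- A `d`-dimensional subspace `W` of `ℝⱽ` is generic if, for a matrix with `d` columns forming a
basis of `W`, every `d × d` submatrix (given by `d` distinct rows) is invertible. This does not
depend on the basis, so it is required of every basis. -/
def IsGeneric {V : Type*} [Fintype V] (W : Submodule ℝ (V → ℝ)) : Prop :=
  ∀ (b : Module.Basis (Fin (Module.finrank ℝ W)) ℝ W) (r : Fin (Module.finrank ℝ W) ↪ V),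
    IsUnit (Matrix.of fun i j => (b j : V → ℝ) (r i))

/-- A subset of `V(G) × V(H)` regarded as a set of edges `{u, v}` between `G` and `H` in the
disjoint union. -/
def crossEdges {V W : Type*} (β : Set (V × W)) : Set (Sym2 (V ⊕ W)) :=
  (fun p => s(Sum.inl p.1, Sum.inr p.2)) '' β

/-- The direct sum `A ⊕ B`. -/
def directSum {V W : Type*} (A : Matrix V V ℝ) (B : Matrix W W ℝ) :
    Matrix (V ⊕ W) (V ⊕ W) ℝ :=
  Matrix.fromBlocks A 0 0 B

end LiberationSet

/-! Two arguments meet here. The algebraic one: a symmetric matrix commuting with `A ⊕ B` has an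
off-diagonal block `Y` with `A * Y = Y * B`. As `lam` is the only common eigenvalue, the columns of
`Y` lie in `ker (A - lam)` and its rows in `ker (B - lam)`. By genericity a row with one zero
vanishes, and so does a column with `k` zeros. Either vanishing propagates: `k` zero rows put `k`
zeros in every column, and a zero column puts a zero in every row. Deleting one edge of `β` still
leaves enough prescribed zeros to start this (`intertwine_eq_zero`); the SSP of `A` and `B` kills
the diagonal blocks.

The analytic one: the orbit of a symmetric `M` under orthogonal conjugation has tangent vectors `[M,
K]` with `K` skew. By duality, the SSP with respect to a graph lets these take any symmetric values
on its non-edges (`HasSSPWrt.exists_commutator`). Liberation thus gives, for each edge of `β`, a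
tangent vector nonzero there and zero on the non-edges of `G + β`. A generic combination is nonzero
on all of `β`, and the implicit function theorem turns it into an isospectral curve
(`exists_exp_conj_mem`). -/

namespace LiberationSet

open Matrix SimpleGraph Filter Topology

/-! ### Curves in a conjugation orbit -/

section Isospectral

variable {R : Type*} [NormedRing R] [NormedAlgebra ℝ R] [FiniteDimensional ℝ R]

/-- The derivative at `0` of the conjugation orbit `Z ↦ exp (-D Z) * a * exp (D Z)`. -/
theorem hasStrictFDerivAt_exp_conj (a : R) (D : R →L[ℝ] R) :
    HasStrictFDerivAt (fun Z : R => NormedSpace.exp (-D Z) * a * NormedSpace.exp (D Z))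
      (((ContinuousLinearMap.mul ℝ R a) - (ContinuousLinearMap.mul ℝ R).flip a).comp D) 0 := by
  have : CompleteSpace R := FiniteDimensional.complete ℝ R
  have h1 : HasStrictFDerivAt (fun Z : R => NormedSpace.exp (D Z)) D 0 := by
    have h : HasStrictFDerivAt (NormedSpace.exp : R → R) (1 : R →L[ℝ] R) (D 0) := by
      rw [map_zero]; exact hasStrictFDerivAt_exp_zero
    exact h.comp (0 : R) D.hasStrictFDerivAt
  have h2 : HasStrictFDerivAt (fun Z : R => NormedSpace.exp (-D Z)) (-D) 0 := by
    have h : HasStrictFDerivAt (NormedSpace.exp : R → R) (1 : R →L[ℝ] R) ((-D) 0) := by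
      rw [map_zero]; exact hasStrictFDerivAt_exp_zero
    exact h.comp (0 : R) (-D).hasStrictFDerivAt
  refine ((h2.mul_const' a).mul' h1).congr_fderiv ?_
  ext Z
  simp [sub_eq_add_neg]

/-- Moving along the orbit of `a` while staying in the kernel of `m`, provided `m` restricted to the
orbit is a submersion at `a`: any tangent vector of the intersection is the velocity of a curve. -/
theorem exists_exp_conj_mem {S ι : Type*} [NormedAddCommGroup S] [NormedSpace ℝ S] [Finite ι]
    (a : R) (D : R →L[ℝ] R) (m : R →L[ℝ] S) [FiniteDimensional ℝ S] (hma : m a = 0)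
    (hsurj : ∀ s, ∃ Z, m (a * D Z - D Z * a) = s)
    (f : ι → R →L[ℝ] ℝ) (Z₀ : R) (hZ₀ : m (a * D Z₀ - D Z₀ * a) = 0)
    (hf : ∀ i, f i (a * D Z₀ - D Z₀ * a) ≠ 0)
    {U : Set R} (hU : U ∈ 𝓝 a) :
    ∃ Z, NormedSpace.exp (-D Z) * a * NormedSpace.exp (D Z) ∈ U ∧
      m (NormedSpace.exp (-D Z) * a * NormedSpace.exp (D Z)) = 0 ∧
      ∀ i, f i (NormedSpace.exp (-D Z) * a * NormedSpace.exp (D Z)) ≠ 0 := by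
  have : CompleteSpace R := FiniteDimensional.complete ℝ R
  set P : R → R := fun Z => NormedSpace.exp (-D Z) * a * NormedSpace.exp (D Z) with hP
  set T : R →L[ℝ] R :=
    ((ContinuousLinearMap.mul ℝ R a) - (ContinuousLinearMap.mul ℝ R).flip a).comp D with hT
  have hTZ : ∀ Z, T Z = a * D Z - D Z * a := fun Z => by simp [hT]
  have hPd : HasStrictFDerivAt P T 0 := hasStrictFDerivAt_exp_conj a D
  have hP0 : P 0 = a := by simp [hP]
  have hF : HasStrictFDerivAt (fun Z => m (P Z)) (m.comp T) 0 :=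
    m.hasStrictFDerivAt.comp (0 : R) hPd
  have hr : (m.comp T).range = ⊤ := by
    refine LinearMap.range_eq_top.2 fun s => ?_
    obtain ⟨Z, hZ⟩ := hsurj s
    exact ⟨Z, by simpa [hTZ] using hZ⟩
  let z : (m.comp T).ker := ⟨Z₀, by simpa [hTZ] using hZ₀⟩
  -- `g` parametrizes the level set `m ∘ P = 0` by the kernel of its derivative, with the inclusion
  -- as derivative at `0`; the line `t • z` therefore lifts to a curve with velocity `Z₀`.
  set g := hF.implicitFunction _ _ hr 0 with hg
  have hm0 : m (P 0) = 0 := by rw [hP0, hma]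
  have hg0 : g 0 = 0 := by
    have := hF.implicitFunction_apply_image hr
    simp only [hm0] at this
    exact this
  have hgd : HasFDerivAt g (m.comp T).ker.subtypeL 0 := by
    have := (hF.to_implicitFunction hr).hasFDerivAt
    simp only [hm0] at this
    exact this
  have hline : HasDerivAt (fun t : ℝ => t • z) z 0 := by
    have h := (hasDerivAt_id (0 : ℝ)).smul_const z
    rwa [one_smul] at h
  have hγ : HasDerivAt (fun t : ℝ => g (t • z)) Z₀ 0 := by
    have h : HasFDerivAt g (m.comp T).ker.subtypeL ((0 : ℝ) • z) := by rwa [zero_smul]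
    exact h.comp_hasDerivAt (0 : ℝ) hline
  have hγ0 : g ((0 : ℝ) • z) = 0 := by rw [zero_smul, hg0]
  have hPγ : HasDerivAt (fun t : ℝ => P (g (t • z))) (T Z₀) 0 := by
    have h : HasFDerivAt P T (g ((0 : ℝ) • z)) := by rw [hγ0]; exact hPd.hasFDerivAt
    exact h.comp_hasDerivAt (0 : ℝ) hγ
  have e1 : ∀ᶠ t : ℝ in 𝓝[≠] 0, P (g (t • z)) ∈ U := by
    refine (hPγ.continuousAt.tendsto.mono_left nhdsWithin_le_nhds).eventually ?_
    rwa [hγ0, hP0]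
  have e2 : ∀ᶠ t : ℝ in 𝓝[≠] 0, m (P (g (t • z))) = 0 := by
    have h := hF.map_implicitFunction_eq hr
    have ht : Tendsto (fun t : ℝ => ((0 : S), t • z)) (𝓝[≠] 0) (𝓝 (m (P 0), 0)) := by
      rw [hm0]
      refine Tendsto.mono_left ?_ nhdsWithin_le_nhds
      refine tendsto_const_nhds.prodMk_nhds ?_
      have h := hline.continuousAt.tendsto
      rwa [zero_smul] at h
    exact ht.eventually h
  -- The derivative at `t = 0` is nonzero, so zero is avoided for small `t ≠ 0`; hence the punctured
  -- neighbourhoods.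
  have e3 : ∀ᶠ t : ℝ in 𝓝[≠] 0, ∀ i, f i (P (g (t • z))) ≠ 0 := by
    refine eventually_all.2 fun i => ?_
    have h : HasDerivAt (fun t : ℝ => f i (P (g (t • z)))) (f i (T Z₀)) 0 :=
      (f i).hasFDerivAt.comp_hasDerivAt (0 : ℝ) hPγ
    exact h.eventually_ne (by rw [hTZ]; exact hf i)
  obtain ⟨t, h1, h2, h3⟩ := (e1.and (e2.and e3)).exists
  exact ⟨g (t • z), h1, h2, h3⟩

end Isospectral

/-! ### Generic eigenspaces and intertwining matrices -/

section Generic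

variable {V W : Type*} [Fintype V] [Fintype W]

/-- A vector of a generic subspace vanishing on at least as many coordinates as the dimension is
zero. -/
theorem IsGeneric.eq_zero {S : Submodule ℝ (V → ℝ)} (hS : IsGeneric S) {x : V → ℝ} (hx : x ∈ S)
    (U : Finset V) (hU : Module.finrank ℝ S ≤ U.card) (h : ∀ u ∈ U, x u = 0) : x = 0 := by
  classical
  let b := Module.finBasis ℝ S
  obtain ⟨r⟩ : Nonempty (Fin (Module.finrank ℝ S) ↪ U) :=
    Function.Embedding.nonempty_of_card_le (by simpa using hU)
  have hunit := hS b (r.trans (Function.Embedding.subtype _))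
  set M := Matrix.of fun i j => (b j : V → ℝ) ((r.trans (Function.Embedding.subtype _)) i) with hM
  set c := b.repr ⟨x, hx⟩ with hc
  have hsum : ∑ j, c j • (b j : V → ℝ) = x := by
    have := congrArg S.subtype (b.sum_repr ⟨x, hx⟩)
    simpa only [map_sum, map_smul, Submodule.subtype_apply] using this
  have hMc : M *ᵥ (fun j => c j) = 0 := by
    ext i
    have h1 := h (r i) (r i).2
    rw [← hsum] at h1
    simpa [Matrix.mulVec, dotProduct, hM, mul_comm, Finset.sum_apply] using h1
  have hc0 : (fun j => c j) = 0 := Matrix.mulVec_injective_of_isUnit hunit (by simpa using hMc)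
  rw [← hsum]
  exact Finset.sum_eq_zero fun j _ => by rw [show c j = 0 from congrFun hc0 j, zero_smul]

variable [DecidableEq V] [DecidableEq W]

theorem mem_eigenKer {A : Matrix V V ℝ} {μ : ℝ} {x : V → ℝ} :
    x ∈ eigenKer A μ ↔ A *ᵥ x = μ • x := by
  simp [eigenKer, sub_eq_zero]

/-- Geometric multiplicity is at most algebraic multiplicity. This direction suffices to bound the
number of zeros needed in `IsGeneric.eq_zero`. -/
theorem finrank_eigenKer_le (A : Matrix V V ℝ) (μ : ℝ) :
    Module.finrank ℝ (eigenKer A μ) ≤ mult A μ := by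
  have h := LinearMap.finrank_eigenspace_le (Matrix.toLin' A) μ
  have he : Module.End.eigenspace (Matrix.toLin' A) μ = eigenKer A μ := by
    ext x
    rw [Module.End.mem_eigenspace_iff, mem_eigenKer, Matrix.toLin'_apply]
  rw [he, Matrix.charpoly_toLin'] at h
  simpa [mult, spec] using h

theorem mem_spec_of_mulVec {A : Matrix V V ℝ} {μ : ℝ} {x : V → ℝ} (hx : x ≠ 0)
    (h : A *ᵥ x = μ • x) : μ ∈ spec A := by
  have h1 : Module.End.HasEigenvalue (Matrix.toLin' A) μ :=
    Module.End.hasEigenvalue_of_hasEigenvector (x := x)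
      ⟨Module.End.mem_eigenspace_iff.2 (by simpa using h), hx⟩
  have h2 := h1.mem_spectrum
  rw [Matrix.spectrum_toLin', Matrix.mem_spectrum_iff_isRoot_charpoly] at h2
  exact (Polynomial.mem_roots (Matrix.charpoly_monic A).ne_zero).2 h2

/-- If `lam` is the only common eigenvalue of `A` and the symmetric matrix `B`, then a matrix
intertwining them is supported on the two `lam`-eigenspaces. -/
theorem mul_eq_smul_of_intertwine {A : Matrix V V ℝ} {B : Matrix W W ℝ} (hB : B.IsSymm) {lam : ℝ}
    (hspec : ∀ μ, μ ∈ spec A → μ ∈ spec B → μ = lam) {Y : Matrix V W ℝ} (hY : A * Y = Y * B) :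
    A * Y = lam • Y := by
  have hH : B.IsHermitian := by
    rw [Matrix.IsHermitian, Matrix.conjTranspose_eq_transpose_of_trivial, hB]
  -- It suffices to test on an eigenbasis of `B`: `Y` sends an eigenvector of `B` to zero or to an
  -- eigenvector of `A` with the same eigenvalue, which must then be `lam`.
  have key : ∀ j, (A * Y) *ᵥ ⇑(hH.eigenvectorBasis j) = (lam • Y) *ᵥ ⇑(hH.eigenvectorBasis j) := by
    intro j
    set w : W → ℝ := ⇑(hH.eigenvectorBasis j) with hw
    have hBw : B *ᵥ w = hH.eigenvalues j • w := hH.mulVec_eigenvectorBasis j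
    have hAYw : A *ᵥ (Y *ᵥ w) = hH.eigenvalues j • (Y *ᵥ w) := by
      rw [Matrix.mulVec_mulVec, hY, ← Matrix.mulVec_mulVec, hBw, Matrix.mulVec_smul]
    rw [← Matrix.mulVec_mulVec, Matrix.smul_mulVec, hAYw]
    by_cases h0 : Y *ᵥ w = 0
    · rw [h0, smul_zero, smul_zero]
    · have hw0 : w ≠ 0 := fun h => h0 (by rw [h, Matrix.mulVec_zero])
      rw [hspec _ (mem_spec_of_mulVec h0 hAYw) (mem_spec_of_mulVec hw0 hBw)]
  have hlin : (Matrix.mulVecLin (A * Y)) ∘ₗ (WithLp.linearEquiv 2 ℝ (W → ℝ)).toLinearMap =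
      (Matrix.mulVecLin (lam • Y)) ∘ₗ (WithLp.linearEquiv 2 ℝ (W → ℝ)).toLinearMap :=
    hH.eigenvectorBasis.toBasis.ext fun j => key j
  refine Matrix.ext_of_mulVec_single fun i => ?_
  have := LinearMap.congr_fun hlin (WithLp.toLp 2 (Pi.single i 1))
  exact this

end Generic

/-! ### The SSP as transversality, and the liberation lemma -/

section Liberation

variable {V : Type*}

/-- `zeroDiagClosure K` as a subspace. -/
def zeroDiagSubmodule (K : SimpleGraph V) : Submodule ℝ (Matrix V V ℝ) where
  carrier := zeroDiagClosure K
  zero_mem' := ⟨Matrix.isSymm_zero, fun i j h => absurd rfl h⟩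
  add_mem' {X Y} hX hY := ⟨hX.1.add hY.1, fun i j h => by
    by_contra hK
    have h1 : X i j = 0 := by_contra fun h' => hK (hX.2 i j h')
    have h2 : Y i j = 0 := by_contra fun h' => hK (hY.2 i j h')
    exact h (by simp [h1, h2])⟩
  smul_mem' c X hX := ⟨hX.1.smul c, fun i j h => hX.2 i j fun h' => h (by simp [h'])⟩

open Classical in
/-- Symmetrize a matrix and keep only its entries on the edges of `K`. -/
noncomputable def symMask (K : SimpleGraph V) : Matrix V V ℝ →ₗ[ℝ] zeroDiagSubmodule K where
  toFun X := ⟨Matrix.of fun i j => if K.Adj i j then (X i j + X j i) / 2 else 0,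
    by ext i j; simp [K.adj_comm, add_comm], fun i j h => by
      by_contra hK; exact h (by simp [hK])⟩
  map_add' X Y := by
    ext i j
    by_cases h : K.Adj i j <;> simp [h]
    ring
  map_smul' c X := by
    ext i j
    by_cases h : K.Adj i j <;> simp [h]
    ring

theorem symMask_apply_of_adj {K : SimpleGraph V} {X : Matrix V V ℝ} (hX : X.IsSymm) {i j : V}
    (h : K.Adj i j) : (symMask K X : Matrix V V ℝ) i j = X i j := by
  simp [symMask, h, hX.apply i j]

theorem symMask_apply_of_not_adj {K : SimpleGraph V} (X : Matrix V V ℝ) {i j : V}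
    (h : ¬ K.Adj i j) : (symMask K X : Matrix V V ℝ) i j = 0 := by
  simp [symMask, h]

theorem symMask_transpose (K : SimpleGraph V) (X : Matrix V V ℝ) :
    symMask K Xᵀ = symMask K X := by
  ext i j
  by_cases h : K.Adj i j <;> simp [symMask, h, add_comm]

theorem symMask_coe {K : SimpleGraph V} (Y : zeroDiagSubmodule K) :
    symMask K (Y : Matrix V V ℝ) = Y := by
  ext i j
  by_cases h : K.Adj i j
  · exact symMask_apply_of_adj Y.2.1 h
  · rw [symMask_apply_of_not_adj _ h]
    by_contra h'
    exact h (Y.2.2 i j (Ne.symm h'))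

theorem symMask_eq_zero_iff {K : SimpleGraph V} {X : Matrix V V ℝ} (hX : X.IsSymm) :
    symMask K X = 0 ↔ ∀ i j, K.Adj i j → X i j = 0 := by
  refine ⟨fun h i j hij => ?_, fun h => ?_⟩
  · rw [← symMask_apply_of_adj hX hij, h]; rfl
  · ext i j
    by_cases hij : K.Adj i j
    · rw [symMask_apply_of_adj hX hij, h i j hij]; rfl
    · rw [symMask_apply_of_not_adj _ hij]; rfl

theorem zeroDiagClosure_mono {K L : SimpleGraph V} (h : K ≤ L) :
    zeroDiagClosure K ⊆ zeroDiagClosure L :=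
  fun _ hX => ⟨hX.1, fun i j hij => h (hX.2 i j hij)⟩

theorem addEdges_mono (G : SimpleGraph V) {β β' : Set (Sym2 V)} (h : β' ⊆ β) :
    addEdges G β' ≤ addEdges G β :=
  sup_le_sup_left (SimpleGraph.fromEdgeSet_mono h) G

theorem addEdges_adj {G : SimpleGraph V} {β : Set (Sym2 V)} {i j : V} :
    (addEdges G β).Adj i j ↔ G.Adj i j ∨ s(i, j) ∈ β ∧ i ≠ j := by
  simp [addEdges]

variable [Fintype V]

theorem HasSSPWrt.mono {A : Matrix V V ℝ} {K L : SimpleGraph V} (h : HasSSPWrt A K) (hKL : K ≤ L) :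
    HasSSPWrt A L :=
  fun X hX => h X (zeroDiagClosure_mono (compl_le_compl hKL) hX)

/-- Since `A` is nonzero on every edge of `K`, the condition `A ∘ X = 0` confines `X` to the
complement of `K`. -/
theorem HasSSPWrt.hasSSP [DecidableEq V] {A : Matrix V V ℝ} {K : SimpleGraph V}
    (hA : A ∈ graphMatrices K) (h : HasSSPWrt A K) : HasSSP A := by
  refine ⟨hA.1, fun X hX hAX hIX hcomm => h X ⟨hX, fun i j hij => ?_⟩ hcomm⟩
  have hne : i ≠ j := by
    rintro rfl
    have := congrFun (congrFun hIX i) i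
    simp at this
    exact hij this
  refine (SimpleGraph.compl_adj _ _ _).2 ⟨hne, fun hK => ?_⟩
  have := congrFun (congrFun hAX i) j
  simp only [Matrix.hadamard_apply, Matrix.zero_apply, mul_eq_zero] at this
  exact this.elim ((hA.2 i j hne).2 hK) hij

/-- The tangent space of the isospectral manifold at `A` surjects onto the off-graph entries exactly
because the only matrix of the commutant supported there is zero. -/
theorem HasSSPWrt.exists_commutator {A : Matrix V V ℝ} (hA : A.IsSymm) {K : SimpleGraph V}
    (h : HasSSPWrt A K) (s : zeroDiagSubmodule Kᶜ) :
    ∃ Z : Matrix V V ℝ, symMask Kᶜ (A * (Z - Zᵀ) - (Z - Zᵀ) * A) = s := by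
  classical
  let T : Matrix V V ℝ →ₗ[ℝ] Matrix V V ℝ :=
    (LinearMap.mulLeft ℝ A - LinearMap.mulRight ℝ A) ∘ₗ
      (LinearMap.id - (Matrix.transposeLinearEquiv V V ℝ ℝ).toLinearMap)
  have hT : ∀ Z, T Z = A * (Z - Zᵀ) - (Z - Zᵀ) * A := fun Z => rfl
  suffices hr : LinearMap.range (symMask Kᶜ ∘ₗ T) = ⊤ by
    obtain ⟨Z, hZ⟩ := LinearMap.range_eq_top.1 hr s
    exact ⟨Z, hZ⟩
  -- Otherwise a nonzero functional `φ` kills the range. The trace form represents it by a symmetric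
  -- `c` supported on `Kᶜ`, which is shown to commute with `A`.
  by_contra hr
  obtain ⟨φ, hφ, hle⟩ := Submodule.exists_le_ker_of_lt_top _ (lt_top_iff_ne_top.2 hr)
  let c : Matrix V V ℝ := Matrix.of fun i j => φ (symMask Kᶜ (Matrix.single i j 1))
  have hcs : c.IsSymm := by
    ext i j
    simp only [c, Matrix.transpose_apply, Matrix.of_apply]
    rw [← symMask_transpose, Matrix.transpose_single]
  have hcmem : c ∈ zeroDiagClosure Kᶜ := by
    refine ⟨hcs, fun i j hij => ?_⟩
    by_contra hK
    refine hij ?_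
    have : symMask Kᶜ (Matrix.single i j (1 : ℝ)) = 0 := by
      ext a b
      by_cases hab : Kᶜ.Adj a b
      · have h1 : ¬ (i = a ∧ j = b) := by rintro ⟨rfl, rfl⟩; exact hK hab
        have h2 : ¬ (i = b ∧ j = a) := by rintro ⟨rfl, rfl⟩; exact hK hab.symm
        simp [symMask, Matrix.single_apply, h1, h2]
      · rw [symMask_apply_of_not_adj _ hab]; rfl
    simp [c, this]
  have hrep : ∀ X : Matrix V V ℝ, φ (symMask Kᶜ X) = (c * X).trace := by
    intro X
    conv_lhs => rw [Matrix.matrix_eq_sum_single X]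
    simp only [map_sum]
    rw [Matrix.trace, Finset.sum_comm]
    refine Finset.sum_congr rfl fun j _ => ?_
    rw [Matrix.diag_apply, Matrix.mul_apply]
    refine Finset.sum_congr rfl fun i _ => ?_
    have : Matrix.single i j (X i j) = X i j • Matrix.single i j (1 : ℝ) := by
      rw [Matrix.smul_single, smul_eq_mul, mul_one]
    rw [this, map_smul, map_smul, smul_eq_mul, mul_comm, ← hcs.apply j i]
    simp [c]
  have hcomm : A * c - c * A = 0 := by
    set M := A * c - c * A with hM
    have hMt : Mᵀ = -M := by
      rw [hM, Matrix.transpose_sub, Matrix.transpose_mul, Matrix.transpose_mul, hA, hcs, neg_sub]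
    -- `M` is skew, so pairing it with `Z - Zᵀ` gives twice its pairing with `Z`; vanishing on skew
    -- matrices thus forces vanishing on all.
    have hZ : ∀ Z, (M * Z).trace = 0 := by
      intro Z
      have h1 : (c * T Z).trace = 0 := by
        rw [← hrep]
        exact hle ⟨Z, rfl⟩
      have h2 : (c * T Z).trace = -(M * (Z - Zᵀ)).trace := by
        rw [hT, hM, Matrix.mul_sub c, Matrix.sub_mul (A * c), Matrix.trace_sub, Matrix.trace_sub,
          ← Matrix.mul_assoc, ← Matrix.mul_assoc c, Matrix.trace_mul_comm (c * (Z - Zᵀ)),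
          ← Matrix.mul_assoc]
        ring
      have h3 : (M * Zᵀ).trace = -(M * Z).trace := by
        rw [← Matrix.trace_transpose, Matrix.transpose_mul, Matrix.transpose_transpose, hMt,
          Matrix.mul_neg, Matrix.trace_neg, Matrix.trace_mul_comm]
      rw [Matrix.mul_sub, Matrix.trace_sub, h3] at h2
      linarith
    refine Matrix.ext_iff_trace_mul_right.2 fun Z => ?_
    rw [hZ, Matrix.zero_mul, Matrix.trace_zero]
  have hc0 := h c hcmem hcomm
  refine hφ (LinearMap.ext fun Y => ?_)
  rw [← symMask_coe Y, hrep, hc0]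
  simp

open scoped Matrix.Norms.Operator

/-- The SSP with respect to a fixed graph is an open condition. -/
theorem isOpen_setOf_hasSSPWrt [DecidableEq V] (K : SimpleGraph V) :
    IsOpen {C : Matrix V V ℝ | HasSSPWrt C K} := by
  let S := zeroDiagSubmodule Kᶜ
  let Φ : Matrix V V ℝ →L[ℝ] (S →L[ℝ] Matrix V V ℝ) := LinearMap.toContinuousLinearMap
    { toFun := fun C => LinearMap.toContinuousLinearMap
        ((LinearMap.mulLeft ℝ C - LinearMap.mulRight ℝ C) ∘ₗ S.subtype)
      map_add' := fun C D => by
        ext1 X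
        simp [add_mul, mul_add]
        abel
      map_smul' := fun a C => by
        ext1 X
        simp [smul_sub] }
  have hΦ : ∀ C X, Φ C X = C * (X : Matrix V V ℝ) - (X : Matrix V V ℝ) * C := fun C X => rfl
  have heq : {C : Matrix V V ℝ | HasSSPWrt C K} =
      -- The SSP is injectivity of the commutator map on a fixed finite-dimensional space, and
      -- injectivity is an open condition.
      Φ ⁻¹' {L : S →L[ℝ] Matrix V V ℝ | Function.Injective L} := by
    ext C
    simp only [Set.mem_ofPred_eq, Set.mem_preimage, injective_iff_map_eq_zero, hΦ]
    exact ⟨fun h X hX => Subtype.ext (h X X.2 hX),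
      fun h X hX hc => congrArg Subtype.val (h ⟨X, hX⟩ hc)⟩
  rw [heq]
  exact ContinuousLinearMap.isOpen_injective.preimage Φ.continuous

/-- The liberation lemma: a matrix with an SSP liberation set `β` can be perturbed, keeping its
spectrum, so that all the edges of `β` appear. -/
theorem IsSSPLiberationSet.exists_isospectral [DecidableEq V] {G : SimpleGraph V}
    {A : Matrix V V ℝ} {β : Set (Sym2 V)} (h : IsSSPLiberationSet G A β) :
    ∃ C ∈ graphMatrices (addEdges G β), HasSSP C ∧ spec C = spec A := by
  obtain ⟨hA, ⟨e, he⟩, hβ, hlib⟩ := h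
  have hcard : ∀ e ∈ β, (β \ {e}).ncard + 1 = β.ncard := fun e he =>
    Set.ncard_sdiff_singleton_add_one he (Set.toFinite β)
  have hdel : ∀ e ∈ β, HasSSPWrt A (addEdges G (β \ {e})) := fun e he =>
    hlib _ Set.sdiff_subset (hcard e he)
  have hK : HasSSPWrt A (addEdges G β) := (hdel e he).mono (addEdges_mono G Set.sdiff_subset)
  have hne : ∀ {i j}, s(i, j) ∈ β → i ≠ j ∧ ¬ G.Adj i j := fun hij => by
    simpa using hβ hij
  let D : Matrix V V ℝ →ₗ[ℝ] Matrix V V ℝ :=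
    LinearMap.id - (Matrix.transposeLinearEquiv V V ℝ ℝ).toLinearMap
  have hD : ∀ Z, D Z = Z - Zᵀ := fun Z => rfl
  let T : Matrix V V ℝ →ₗ[ℝ] Matrix V V ℝ := (LinearMap.mulLeft ℝ A - LinearMap.mulRight ℝ A) ∘ₗ D
  have hT : ∀ Z, T Z = A * (Z - Zᵀ) - (Z - Zᵀ) * A := fun Z => rfl
  have hTs : ∀ Z, (T Z).IsSymm := fun Z => by
    rw [Matrix.IsSymm, hT, Matrix.transpose_sub, Matrix.transpose_mul, Matrix.transpose_mul, hA.1,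
      Matrix.transpose_sub, Matrix.transpose_transpose]
    noncomm_ring
  let entry : {p : V × V // s(p.1, p.2) ∈ β} → (Matrix V V ℝ →ₗ[ℝ] ℝ) := fun p =>
    Matrix.entryLinearMap ℝ ℝ p.1.1 p.1.2
  have hentry : ∀ p X, entry p X = X p.1.1 p.1.2 := fun p X => rfl
  let m := symMask (addEdges G β)ᶜ
  have hmA : m A = 0 := by
    refine (symMask_eq_zero_iff hA.1).2 fun i j hij => ?_
    rw [SimpleGraph.compl_adj, addEdges_adj] at hij
    by_contra h0
    exact hij.2 (Or.inl ((hA.2 i j hij.1).1 h0))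
  -- Finitely many functionals, none zero on the kernel, have a common non-zero point there. For the
  -- edge `uv`, the witness comes from the SSP with respect to `G + (β \ {uv})`, prescribing the
  -- symmetric unit at `uv`.
  obtain ⟨Z₀, hZ₀, hZ₀f⟩ := Module.Dual.exists_forall_mem_ne_zero_of_forall_exists
      (LinearMap.ker (m ∘ₗ T)) (fun p => entry p ∘ₗ T) (by
    rintro ⟨⟨u, v⟩, hp⟩
    have hp' := hne hp
    have hadj : (addEdges G (β \ {s(u, v)}))ᶜ.Adj u v := by
      rw [SimpleGraph.compl_adj, addEdges_adj]
      exact ⟨hp'.1, by simp [hp'.2]⟩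
    obtain ⟨Z, hZ⟩ := (hdel _ hp).exists_commutator hA.1
      (symMask _ (Matrix.single u v 1 + Matrix.single v u 1))
    have hsym : (Matrix.single u v (1 : ℝ) + Matrix.single v u 1).IsSymm := by
      rw [Matrix.IsSymm, Matrix.transpose_add, Matrix.transpose_single, Matrix.transpose_single,
        add_comm]
    have hval : ∀ i j, (addEdges G (β \ {s(u, v)}))ᶜ.Adj i j →
        T Z i j = (Matrix.single u v (1 : ℝ) + Matrix.single v u 1 : Matrix V V ℝ) i j := by
      intro i j hij
      rw [← symMask_apply_of_adj (hTs Z) hij, hT, hZ, symMask_apply_of_adj hsym hij]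
    refine ⟨Z, (symMask_eq_zero_iff (hTs Z)).2 fun i j hij => ?_, ?_⟩
    · have hle := compl_le_compl (addEdges_mono G (Set.sdiff_subset (s := β) (t := {s(u, v)})))
      rw [hval i j (hle hij)]
      rw [SimpleGraph.compl_adj, addEdges_adj] at hij
      have h1 : ¬ (u = i ∧ v = j) := by
        rintro ⟨rfl, rfl⟩; exact hij.2 (Or.inr ⟨hp, hij.1⟩)
      have h2 : ¬ (v = i ∧ u = j) := by
        rintro ⟨rfl, rfl⟩; exact hij.2 (Or.inr ⟨Sym2.eq_swap ▸ hp, hij.1⟩)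
      simp [h1, h2]
    · have h1 : ¬ (v = u ∧ u = v) := fun h => hp'.1 h.2
      simp only [LinearMap.comp_apply, hentry, hval u v hadj]
      simp [h1])
  have hU : {C : Matrix V V ℝ | HasSSPWrt C (addEdges G β)} ∩
      {C | ∀ i j, A i j ≠ 0 → C i j ≠ 0} ∈ 𝓝 A := by
    refine inter_mem ((isOpen_setOf_hasSSPWrt _).mem_nhds hK) ?_
    refine eventually_all.2 fun i => eventually_all.2 fun j => eventually_imp_distrib_left.2 fun h => ?_
    exact (continuous_id.matrix_elem i j).continuousAt.eventually_ne h
  obtain ⟨Z, ⟨hSSP, hnz⟩, hm, hf⟩ := exists_exp_conj_mem A (LinearMap.toContinuousLinearMap D)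
    (LinearMap.toContinuousLinearMap m) hmA (hK.exists_commutator hA.1)
    (fun p => LinearMap.toContinuousLinearMap (entry p)) Z₀ hZ₀ hZ₀f hU
  simp only [LinearMap.coe_toContinuousLinearMap'] at hSSP hnz hm hf
  set C := NormedSpace.exp (-D Z) * A * NormedSpace.exp (D Z) with hC
  -- `D Z` is skew, so `exp (D Z)` is orthogonal and the conjugation preserves symmetry.
  have hDt : (D Z)ᵀ = -D Z := by rw [hD, Matrix.transpose_sub, Matrix.transpose_transpose, neg_sub]
  have hCs : C.IsSymm := by
    rw [Matrix.IsSymm, hC, Matrix.transpose_mul, Matrix.transpose_mul, ← Matrix.exp_transpose,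
      ← Matrix.exp_transpose, Matrix.transpose_neg, hDt, neg_neg, hA.1, Matrix.mul_assoc]
  have hCmem : C ∈ graphMatrices (addEdges G β) := by
    refine ⟨hCs, fun i j hij => ⟨fun h0 => ?_, fun hadj => ?_⟩⟩
    · by_contra hadj
      exact h0 ((symMask_eq_zero_iff hCs).1 hm i j ((SimpleGraph.compl_adj _ _ _).2 ⟨hij, hadj⟩))
    · rcases addEdges_adj.1 hadj with hG | ⟨hb, -⟩
      · exact hnz i j ((hA.2 i j hij).2 hG)
      · exact hf ⟨(i, j), hb⟩
  refine ⟨C, hCmem, hSSP.hasSSP hCmem, ?_⟩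
  obtain ⟨u, hu⟩ := Matrix.isUnit_exp (D Z)
  rw [spec, spec, hC, Matrix.exp_neg, ← hu, Matrix.charpoly_units_conj']

end Liberation

/-! ### Reduction of the direct sum to its off-diagonal block -/

section DirectSum

variable {V W : Type*}

theorem injective_crossEdge :
    Function.Injective (fun p : V × W => s(Sum.inl p.1, (Sum.inr p.2 : V ⊕ W))) := by
  rintro ⟨a, b⟩ ⟨c, d⟩ h
  simpa using h

theorem directSum_mem_graphMatrices {G : SimpleGraph V} {H : SimpleGraph W} {A : Matrix V V ℝ}
    {B : Matrix W W ℝ} (hA : A ∈ graphMatrices G) (hB : B ∈ graphMatrices H) :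
    directSum A B ∈ graphMatrices (G.sum H) := by
  refine ⟨Matrix.IsSymm.fromBlocks hA.1 (by simp) hB.1, ?_⟩
  rintro (i | i) (j | j) hij
  · simpa [directSum] using hA.2 i j (by simpa using hij)
  · simp [directSum]
  · simp [directSum]
  · simpa [directSum] using hB.2 i j (by simpa using hij)

variable [Fintype V] [DecidableEq V] [Fintype W] [DecidableEq W]

theorem spec_directSum (A : Matrix V V ℝ) (B : Matrix W W ℝ) :
    spec (directSum A B) = spec A + spec B := by
  rw [spec, directSum, Matrix.charpoly_fromBlocks_zero₁₂, Polynomial.roots_mul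
    (mul_ne_zero (Matrix.charpoly_monic A).ne_zero (Matrix.charpoly_monic B).ne_zero), spec, spec]

/-- Enlarging the graph from `G` to `K` only shrinks the admissible supports of `X`. -/
theorem HasSSP.eq_zero_of_mem_zeroDiagClosure {A X : Matrix V V ℝ} {G K : SimpleGraph V}
    (h : HasSSP A) (hA : A ∈ graphMatrices G) (hGK : G ≤ K) (hX : X ∈ zeroDiagClosure Kᶜ)
    (hc : A * X - X * A = 0) : X = 0 := by
  have hd : ∀ i, X i i = 0 := fun i => by_contra fun h' => (hX.2 i i h').ne rfl
  refine h.2 X hX.1 ?_ ?_ hc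
  · ext i j
    rw [Matrix.hadamard_apply, Matrix.zero_apply, mul_eq_zero, or_iff_not_imp_right]
    intro h0
    have hadj := (SimpleGraph.compl_adj _ _ _).1 (hX.2 i j h0)
    by_contra h1
    exact hadj.2 (hGK ((hA.2 i j hadj.1).1 h1))
  · ext i j
    by_cases hij : i = j
    · subst hij; simp [hd]
    · simp [hij]

/-- The SSP of `A ⊕ B` with respect to a graph reduces to the vanishing of the intertwining
off-diagonal blocks. -/
theorem hasSSPWrt_directSum {G : SimpleGraph V} {H : SimpleGraph W} {A : Matrix V V ℝ}
    {B : Matrix W W ℝ} (hA : A ∈ graphMatrices G) (hB : B ∈ graphMatrices H) (hASSP : HasSSP A)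
    (hBSSP : HasSSP B) (β : Set (V × W))
    (h : ∀ Y : Matrix V W ℝ, A * Y = Y * B → (∀ p ∈ β, Y p.1 p.2 = 0) → Y = 0) :
    HasSSPWrt (directSum A B) (addEdges (G.sum H) (crossEdges β)) := by
  intro X hX hc
  have hXs : ∀ i j, X j i = X i j := hX.1.apply
  rw [← Matrix.fromBlocks_toBlocks X, directSum, Matrix.fromBlocks_multiply,
    Matrix.fromBlocks_multiply, sub_eq_zero, Matrix.fromBlocks_inj] at hc
  simp only [Matrix.zero_mul, Matrix.mul_zero, add_zero, zero_add] at hc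
  obtain ⟨h11, h12, -, h22⟩ := hc
  have e11 : X.toBlocks₁₁ = 0 := by
    refine hASSP.eq_zero_of_mem_zeroDiagClosure hA le_rfl ⟨?_, fun i j hij => ?_⟩
      (sub_eq_zero.2 h11)
    · ext i j; exact hXs _ _
    · have := hX.2 (Sum.inl i) (Sum.inl j) hij
      simp only [SimpleGraph.compl_adj, addEdges_adj] at this ⊢
      exact ⟨fun e => this.1 (by rw [e]), fun hG => this.2 (Or.inl (by simpa using hG))⟩
  have e22 : X.toBlocks₂₂ = 0 := by
    refine hBSSP.eq_zero_of_mem_zeroDiagClosure hB le_rfl ⟨?_, fun i j hij => ?_⟩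
      (sub_eq_zero.2 h22)
    · ext i j; exact hXs _ _
    · have := hX.2 (Sum.inr i) (Sum.inr j) hij
      simp only [SimpleGraph.compl_adj, addEdges_adj] at this ⊢
      exact ⟨fun e => this.1 (by rw [e]), fun hG => this.2 (Or.inl (by simpa using hG))⟩
  have e12 : X.toBlocks₁₂ = 0 := by
    refine h _ h12 fun p hp => ?_
    by_contra h0
    have := hX.2 (Sum.inl p.1) (Sum.inr p.2) h0
    simp only [SimpleGraph.compl_adj, addEdges_adj] at this
    exact this.2 (Or.inr ⟨⟨p, hp, rfl⟩, by simp⟩)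
  have e21 : X.toBlocks₂₁ = 0 := by
    ext i j
    have := congrFun (congrFun e12 j) i
    simpa [Matrix.toBlocks₂₁, Matrix.toBlocks₁₂, hXs (Sum.inl j) (Sum.inr i)] using this
  rw [← Matrix.fromBlocks_toBlocks X, e11, e12, e21, e22, Matrix.fromBlocks_zero]

end DirectSum

/-! ### Propagation of zeros and the theorem -/

variable {V W : Type*} [Fintype V] [DecidableEq V] [Fintype W] [DecidableEq W]

/-- An intertwining matrix of `A` and `B` vanishing on `γ` is zero as soon as `γ` meets the rows of
`k` vertices, or meets a column in `k` vertices. -/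
theorem intertwine_eq_zero {A : Matrix V V ℝ} {B : Matrix W W ℝ} (hB : B.IsSymm) {lam : ℝ} {k : ℕ}
    (hspec : ∀ μ, μ ∈ spec A → μ ∈ spec B → μ = lam)
    (hkA : mult A lam = k) (hkB : mult B lam = 1)
    (hgenA : IsGeneric (eigenKer A lam)) (hgenB : IsGeneric (eigenKer B lam))
    {Y : Matrix V W ℝ} (hY : A * Y = Y * B) (U : Finset V) (hU : k ≤ U.card)
    (h : (∀ u ∈ U, ∃ v, Y u v = 0) ∨ ∃ v, (∀ u ∈ U, Y u v = 0)) : Y = 0 := by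
  have hAY := mul_eq_smul_of_intertwine hB hspec hY
  have hYB : Y * B = lam • Y := hY ▸ hAY
  -- The `lam`-eigenspace of `B` has dimension at most one, so a single zero coordinate kills a
  -- vector in it.
  have hrow : ∀ u v, Y u v = 0 → Y u = 0 := by
    intro u v huv
    refine hgenB.eq_zero (mem_eigenKer.2 ?_) {v}
      ((finrank_eigenKer_le B lam).trans (by simp [hkB])) (by simpa using huv)
    have := congrFun hYB u
    rw [Matrix.mul_apply_eq_vecMul, ← Matrix.mulVec_transpose, hB] at this
    exact this
  have hcol : ∀ v, (∀ u ∈ U, Y u v = 0) → ∀ u, Y u v = 0 := by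
    intro v hv
    refine congrFun (hgenA.eq_zero (x := fun u => Y u v) (mem_eigenKer.2 ?_) U
      ((finrank_eigenKer_le A lam).trans (by rwa [hkA])) hv)
    ext u
    exact congrFun (congrFun hAY u) v
  rcases h with h | ⟨v, hv⟩
  · ext u v
    refine hcol v (fun u hu => ?_) u
    obtain ⟨v', hv'⟩ := h u hu
    exact congrFun (hrow u v' hv') v
  · ext u w
    exact congrFun (hrow u v (hcol v hv u)) w

omit [DecidableEq V] [DecidableEq W] in
theorem ncard_inter_le_of_ncard_add_one {β γ : Set (V × W)} (hγ : γ ⊆ β)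
    (hcard : γ.ncard + 1 = β.ncard) (S : Set (V × W)) :
    (β ∩ S).ncard ≤ (γ ∩ S).ncard + 1 := by
  have h1 : (β \ γ).ncard = 1 := by
    have := Set.ncard_sdiff_add_ncard_of_subset hγ (Set.toFinite β)
    omega
  have h2 : β ∩ S ⊆ (γ ∩ S) ∪ (β \ γ) := fun p hp => by
    by_cases h : p ∈ γ
    · exact Or.inl ⟨h, hp.2⟩
    · exact Or.inr ⟨hp.1, h⟩
  calc (β ∩ S).ncard ≤ ((γ ∩ S) ∪ (β \ γ)).ncard := Set.ncard_le_ncard h2 (Set.toFinite _)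
    _ ≤ (γ ∩ S).ncard + (β \ γ).ncard := Set.ncard_union_le _ _
    _ = (γ ∩ S).ncard + 1 := by rw [h1]

end LiberationSet

theorem theorem3p6 {V W : Type*} [Fintype V] [DecidableEq V] [Fintype W] [DecidableEq W]
    (G : SimpleGraph V) (H : SimpleGraph W)
    (A : Matrix V V ℝ) (B : Matrix W W ℝ)
    (hA : A ∈ LiberationSet.graphMatrices G) (hB : B ∈ LiberationSet.graphMatrices H)
    (hASSP : LiberationSet.HasSSP A) (hBSSP : LiberationSet.HasSSP B)
    (lam : ℝ) (k : ℕ)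
    (hspec : (LiberationSet.spec A).toFinset ∩ (LiberationSet.spec B).toFinset = {lam})
    (hkA : LiberationSet.mult A lam = k) (hkB : LiberationSet.mult B lam = 1)
    (hgenA : LiberationSet.IsGeneric (LiberationSet.eigenKer A lam))
    (hgenB : LiberationSet.IsGeneric (LiberationSet.eigenKer B lam))
    (β : Set (V × W))
    (hβ : (∃ U : Finset V, U.card = k ∧ ∀ u ∈ U, (β ∩ ({u} ×ˢ Set.univ)).ncard = 2) ∨
      (∃ v : W, (β ∩ (Set.univ ×ˢ {v})).ncard = k + 1) ∨
      (k = 1 ∧ β.ncard = 2)) :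
    LiberationSet.IsSSPLiberationSet (G.sum H) (LiberationSet.directSum A B)
        (LiberationSet.crossEdges β) ∧
      ∃ C ∈ LiberationSet.graphMatrices
          (LiberationSet.addEdges (G.sum H) (LiberationSet.crossEdges β)),
        LiberationSet.HasSSP C ∧
          LiberationSet.spec C = LiberationSet.spec A + LiberationSet.spec B := by
  open LiberationSet in
  have hcommon : ∀ μ, μ ∈ spec A → μ ∈ spec B → μ = lam := fun μ h1 h2 => by
    have : μ ∈ (spec A).toFinset ∩ (spec B).toFinset := by simp [h1, h2]
    simpa [hspec] using this
  have hk : 0 < k := by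
    have : lam ∈ (spec A).toFinset ∩ (spec B).toFinset := by simp [hspec]
    rw [← hkA]
    exact Multiset.count_pos.2 (by simpa using (Finset.mem_inter.1 this).1)
  have hne : β.Nonempty := by
    rcases hβ with ⟨U, hUk, hU⟩ | ⟨v, hv⟩ | ⟨-, h2⟩
    · obtain ⟨u, hu⟩ := Finset.card_pos.1 (hUk ▸ hk)
      exact (Set.nonempty_of_ncard_ne_zero (by rw [hU u hu]; norm_num)).mono Set.inter_subset_left
    · exact (Set.nonempty_of_ncard_ne_zero (by rw [hv]; omega)).mono Set.inter_subset_left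
    · exact Set.nonempty_of_ncard_ne_zero (by rw [h2]; norm_num)
  have hlib : IsSSPLiberationSet (G.sum H) (directSum A B) (crossEdges β) := by
    refine ⟨directSum_mem_graphMatrices hA hB, hne.image _, ?_, fun β' hβ' hcard => ?_⟩
    · rintro _ ⟨p, -, rfl⟩
      simp
    obtain ⟨γ, hγβ, rfl⟩ := Set.subset_image_iff.1 hβ'
    have hcard' : γ.ncard + 1 = β.ncard := by
      rwa [crossEdges, Set.ncard_image_of_injective _ injective_crossEdge,
        Set.ncard_image_of_injective _ injective_crossEdge] at hcard
    have hle := ncard_inter_le_of_ncard_add_one hγβ hcard'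
    refine hasSSPWrt_directSum hA hB hASSP hBSSP γ fun Y hY hYγ => ?_
    have hzero := intertwine_eq_zero hB.1 hcommon hkA hkB hgenA hgenB hY
    rcases hβ with ⟨U, hUk, hU⟩ | ⟨v, hv⟩ | ⟨rfl, h2⟩
    · refine hzero U hUk.ge (Or.inl fun u hu => ?_)
      have h1 := hle ({u} ×ˢ Set.univ)
      rw [hU u hu] at h1
      obtain ⟨⟨u', v⟩, hp, hpu, -⟩ :=
        Set.nonempty_of_ncard_ne_zero (s := γ ∩ ({u} ×ˢ Set.univ)) (by omega)
      obtain rfl : u' = u := hpu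
      exact ⟨v, hYγ _ hp⟩
    · have h1 := hle (Set.univ ×ˢ {v})
      rw [hv] at h1
      -- Within one column, pairs are determined by their row, so the remaining `k` or more edges
      -- give as many distinct zero rows of that column.
      have hinj : Set.InjOn Prod.fst (γ ∩ (Set.univ ×ˢ {v})) := by
        rintro ⟨a, b⟩ ⟨-, -, hb⟩ ⟨c, d⟩ ⟨-, -, hd⟩ hac
        exact Prod.ext hac (Eq.trans hb (Eq.symm hd))
      have hfin : (Prod.fst '' (γ ∩ (Set.univ ×ˢ {v}))).Finite := Set.toFinite _
      refine hzero hfin.toFinset ?_ (Or.inr ⟨v, fun u hu => ?_⟩)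
      · rw [← Set.ncard_eq_toFinset_card _ hfin, hinj.ncard_image]
        omega
      · obtain ⟨⟨a, b⟩, ⟨hp, -, hb⟩, rfl⟩ := hfin.mem_toFinset.1 hu
        obtain rfl : b = v := hb
        exact hYγ _ hp
    -- For `k = 1` the one remaining edge is already a column with `k` zeros, wherever the two edges
    -- lie.
    · obtain ⟨⟨u, v⟩, hp⟩ := Set.nonempty_of_ncard_ne_zero (s := γ) (by omega)
      refine hzero {u} (by simp) (Or.inr ⟨v, fun u' hu' => ?_⟩)
      rw [Finset.mem_singleton.1 hu']
      exact hYγ _ hp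
  obtain ⟨C, hC, hCSSP, hCspec⟩ := hlib.exists_isospectral
  exact ⟨hlib, C, hC, hCSSP, hCspec.trans (spec_directSum A B)⟩
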